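/- Let $q$ be a power of an odd prime $p$, let $e$ be a positive integer, and let $\mathrm{Tr}$ be the trace from $\mathbb{F}_{q^4}$ to $\mathbb{F}_q$. For $m=2\ell$ with $m/\gcd(m,e)$ even put $\epsilon=0$ if $\ell/\gcd(m,e)$ is odd and $\epsilon=\gcd(m,e)$ if $\ell/\gcd(m,e)$ is even. Assume that $m=4$ and $\epsilon=1$ (that is, $e$ is odd, for example $e=1,3$). For $u\in\mathbb{F}_q$ let $$D_1=\{x\in\mathbb{F}_{q^4}^*:\mathrm{Tr}(x^{q^e+1})=u,\ \mathrm{Tr}(x)=0\}=\{d_1,\dots,d_n\},\qquad \mathcal{C}_{D_1}=\{(\mathrm{Tr}(bd_1),\dots,\mathrm{Tr}(bd_n)):b\in\mathbb{F}_{q^4}\}.$$ Let $\eta_1$ be the quadratic character of $\mathbb{F}_q$ with $\eta_1(0)=0$, and let $m_p\in\mathbb{F}_p$ be the residue of $m=4$ modulo $p$. 1) If $u=0$, then $\mathcal{C}_{D_1}$ is a one-weight $[q^2-1,\,2,\,q^2-q]$ linear code over $\mathbb{F}_q$ with weight enumerator $1+(q^2-1)z^{(q-1)q}$. 2) If $u\ne0$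 and $\eta_1(-um_p)=-1$, then $\mathcal{C}_{D_1}$ is a two-weight $[2q^2,\,3,\,2q^2-2q]$ linear code over $\mathbb{F}_q$ with weight enumerator $1+(q^3-q)z^{2q(q-1)}+(q-1)z^{2q^2}$. In both cases the code meets the Griesmer bound, i.e. its parameters $[n,k,d]$ satisfy $n=\sum_{i=0}^{k-1}\lceil d/q^i\rceil$, and it is optimal: every $[n',k',d']$ linear code over $\mathbb{F}_q$ with $n'\le n$, $k'\ge k$ and $d'\ge d$ has $n'=n$, $k'=k$ and $d'=d$. -/

import Mathlib

namespace FewWeight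

section Codes

variable {F : Type*} [Field F] [DecidableEq F] {ι : Type*} [Fintype ι]

/-- `d` is the minimum Hamming distance of the linear code `C`. -/
def HasMinDist (C : Submodule F (ι → F)) (d : ℕ) : Prop :=
  IsLeast {w : ℕ | ∃ x ∈ C, ∃ y ∈ C, x ≠ y ∧ hammingDist x y = w} d

/-- `C` is an `[n, k, d]` linear code: it has length `n`, dimension `k`, and minimum Hamming
distance `d`. -/
def HasParams (C : Submodule F (ι → F)) (n k d : ℕ) : Prop :=
  Fintype.card ι = n ∧ Module.finrank F C = k ∧ HasMinDist C d

/-- `A_w`, the number of codewords of Hamming weight `w`. -/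
noncomputable def weightCount (C : Submodule F (ι → F)) (w : ℕ) : ℕ :=
  {c : ι → F | c ∈ C ∧ hammingNorm c = w}.ncard

/-- The weight enumerator `A_0 + A_1 z + ⋯ + A_n z ^ n` (with `A_0 = 1`, the zero word). -/
noncomputable def weightEnumerator (C : Submodule F (ι → F)) : Polynomial ℤ :=
  ∑ w ∈ Finset.range (Fintype.card ι + 1),
    Polynomial.C (weightCount C w : ℤ) * Polynomial.X ^ w

/-- `C` is a `t`-weight code: exactly `t` of the numbers `A_1, …, A_n` are nonzero. -/
def IsWeightCode (C : Submodule F (ι → F)) (t : ℕ) : Prop :=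
  {w ∈ Finset.Icc 1 (Fintype.card ι) | weightCount C w ≠ 0}.card = t

/-- The `[n, k, d]` linear code `C` is optimal: no linear code over the same field has length at
most `n`, dimension at least `k` and minimum distance at least `d`, one of these strictly. -/
def IsOptimal (C : Submodule F (ι → F)) (n k d : ℕ) : Prop :=
  HasParams C n k d ∧
    ∀ (n' k' d' : ℕ) (C' : Submodule F (Fin n' → F)), HasParams C' n' k' d' →
      n' ≤ n → k ≤ k' → d ≤ d' → n' = n ∧ k' = k ∧ d' = d

end Codes

/-- Equality in the Griesmer bound `n ≥ ∑_{i < k} ⌈d / q ^ i⌉` for `q`-ary `[n, k, d]` codes. -/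
def MeetsGriesmer (q n k d : ℕ) : Prop :=
  n = ∑ i ∈ Finset.range k, ⌈(d : ℚ) / (q : ℚ) ^ i⌉₊

section TraceCodes

variable (F : Type*) {K : Type*} [Field F] [Field K] [Algebra F K]

/-- The code `{(Tr (b * d))_{d ∈ D} : b ∈ K}`, with coordinates indexed by the set `D`. -/
noncomputable def traceCode (D : Finset K) : Submodule F (D → F) :=
  LinearMap.range
    (LinearMap.pi fun d : D => Algebra.trace F K ∘ₗ LinearMap.mulRight F (d : K))

variable (K) in
/-- The set `{x ∈ K \ {0} : Tr (x ^ (q ^ e + 1)) = u, Tr x = v}`, where `q = |F|`. -/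
noncomputable def definingSet [Fintype F] [DecidableEq F] [Fintype K] [DecidableEq K]
    (e : ℕ) (u v : F) : Finset K :=
  {x : K | x ≠ 0 ∧ Algebra.trace F K (x ^ (Fintype.card F ^ e + 1)) = u ∧
    Algebra.trace F K x = v}

end TraceCodes

/-- For `m = 2 * l` with `m / gcd m e` even: `0` if `l / gcd m e` is odd, and `gcd m e` if
`l / gcd m e` is even. -/
def epsilon (m e : ℕ) : ℕ :=
  if Odd (m / 2 / Nat.gcd m e) then 0 else Nat.gcd m e

end FewWeight

/-! Everything is read off from L(x) = x + x^(q^2) (`addFrobSq`), whose kernel is 2-dimensional over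
F. Grouping conjugates gives Tr(x) = L(x) + L(x)^q and, for odd e, Tr(x^(q^e+1)) = L(x) · L(x)^q. On
Tr = 0 one has L(x)^q = -L(x), so the defining condition becomes L(x)^2 = -u.

If u = 0, the set is ker L without 0, and each functional Tr(b·) that is nonzero on ker L has q^2 -
q nonzeros there. If u ≠ 0, then since 4 is a square the hypothesis says that -u is a nonsquare, and
the set is the union of two cosets ±z + ker L (`exists_addFrobSq_sq_eq`, `definingSet_eq_union`). A
functional nonzero on ker L has q^2 - q nonzeros on each coset; one vanishing on ker L is constant
on each, with values ±Tr(bz), giving weight 0 or 2q^2. The latter words form a line, hence q - 1 of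
weight 2q^2.

Optimality is formal: the Griesmer sum increases strictly with both k and d, so equality in the
bound leaves no room for improvement. -/

namespace FewWeight

/-! ### Griesmer bound and optimality. -/

section CodeBounds

variable {F : Type*} [Field F] [DecidableEq F]

theorem HasMinDist.le_hammingNorm {ι : Type*} [Fintype ι] {C : Submodule F (ι → F)} {d : ℕ}
    (h : HasMinDist C d) {c : ι → F} (hc : c ∈ C) (h0 : c ≠ 0) : d ≤ hammingNorm c :=
  h.2 ⟨c, hc, 0, C.zero_mem, h0, hammingDist_zero_right c⟩

theorem hasMinDist_of_hammingNorm {ι : Type*} [Fintype ι] {C : Submodule F (ι → F)} {d : ℕ}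
    (hex : ∃ c ∈ C, c ≠ 0 ∧ hammingNorm c = d)
    (hle : ∀ c ∈ C, c ≠ 0 → d ≤ hammingNorm c) : HasMinDist C d := by
  constructor
  · obtain ⟨c, hc, h0, hd⟩ := hex
    exact ⟨c, hc, 0, C.zero_mem, h0, by rw [hammingDist_zero_right, hd]⟩
  · rintro w ⟨x, hx, y, hy, hxy, rfl⟩
    rw [hammingDist_eq_hammingNorm]
    apply hle
    · simpa [sub_eq_add_neg, add_comm] using C.sub_mem hy hx
    · intro h
      apply hxy
      exact (neg_add_eq_zero.mp h)

variable [Fintype F]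

/-- Summing the weights of the words `x - a c` over all scalars `a`. -/
theorem sum_hammingNorm_sub_smul {ι : Type*} [Fintype ι] (x c : ι → F) :
    ∑ a : F, hammingNorm (x - a • c) =
      (Fintype.card F - 1) * hammingNorm c +
        Fintype.card F * hammingNorm (fun i : {i // c i = 0} => x i) := by
  classical
  -- Where c is nonzero exactly one scalar kills the coordinate; where c vanishes, a has no
  -- influence.
  have hcol : ∀ i : ι, (∑ a : F, if (x - a • c) i ≠ 0 then 1 else 0) =
      (Fintype.card F - 1) * (if c i ≠ 0 then 1 else 0) +
        Fintype.card F * (if c i = 0 then (if x i ≠ 0 then 1 else 0) else 0) := by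
    intro i
    by_cases hc : c i = 0
    · by_cases hx : x i = 0 <;> simp [hc, hx]
    · have : (Finset.univ.filter fun a : F => (x - a • c) i ≠ 0) =
          Finset.univ.erase (x i / c i) := by
        ext a
        simp only [Pi.sub_apply, Pi.smul_apply, smul_eq_mul, Finset.mem_filter, Finset.mem_univ,
          true_and, Finset.mem_erase, and_true, ne_eq, sub_eq_zero, eq_div_iff hc]
        exact not_congr eq_comm
      rw [← Finset.card_filter, this]
      simp [hc]
  have hZ : hammingNorm (fun i : {i // c i = 0} => x i) =
      ∑ i, if c i = 0 then (if x i ≠ 0 then 1 else 0) else 0 := by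
    rw [hammingNorm, Finset.card_filter]
    exact ((Finset.sum_filter (fun i => c i = 0) _).symm.trans
      (Finset.sum_subtype (p := fun i => c i = 0) (Finset.univ.filter fun i => c i = 0)
        (by simp) fun i => if x i ≠ 0 then 1 else 0)).symm
  calc ∑ a : F, hammingNorm (x - a • c)
      = ∑ i, ∑ a : F, if (x - a • c) i ≠ 0 then 1 else 0 := by
        rw [Finset.sum_comm]
        exact Finset.sum_congr rfl fun a _ => by rw [hammingNorm, Finset.card_filter]
    _ = _ := by
        rw [Finset.sum_congr rfl fun i _ => hcol i, Finset.sum_add_distrib, ← Finset.mul_sum,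
          ← Finset.mul_sum, hZ]
        congr 2
        rw [hammingNorm, Finset.card_filter]

/-- The Griesmer bound. -/
theorem griesmer_bound (k : ℕ) {ι : Type*} [Fintype ι] (C : Submodule F (ι → F)) (δ : ℚ)
    (hk : Module.finrank F C = k) (hδ : ∀ c ∈ C, c ≠ 0 → δ ≤ hammingNorm c) :
    ∑ i ∈ Finset.range k, ⌈δ / (Fintype.card F : ℚ) ^ i⌉₊ ≤ Fintype.card ι := by
  classical
  induction k generalizing ι δ with
  | zero => simp
  | succ k ih =>
    have hne : ({c : ι → F | c ∈ C ∧ c ≠ 0}).Nonempty := by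
      obtain ⟨c, hc, h0⟩ := C.exists_mem_ne_zero_of_ne_bot (by
        rintro rfl
        simp at hk)
      exact ⟨c, hc, h0⟩
    obtain ⟨c, ⟨hcC, hc0⟩, hmin⟩ := Set.exists_min_image _ (fun c : ι → F => hammingNorm c)
      (Set.toFinite _) hne
    -- Residual code: keep only the coordinates where the minimum-weight word c vanishes.
    set ρ : (ι → F) →ₗ[F] ({i // c i = 0} → F) := LinearMap.funLeft F F Subtype.val with hρ
    have hρa : ∀ x i, ρ x i = x i := fun x i => rfl
    have hρc : ρ c = 0 := by
      ext i
      exact i.2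
    -- Such an x is supported inside the support of c. Cancelling one more coordinate gives a word
    -- lighter than c, hence zero.
    have hker : ∀ x ∈ C, ρ x = 0 → ∃ a : F, a • c = x := by
      intro x hx hx0
      obtain ⟨j, hj⟩ := Function.ne_iff.mp hc0
      refine ⟨x j / c j, ?_⟩
      by_contra hne'
      have hmem : x - (x j / c j) • c ∈ C := C.sub_mem hx (C.smul_mem _ hcC)
      have hle := hmin _ ⟨hmem, fun h => hne' (sub_eq_zero.mp h).symm⟩
      refine absurd hle (not_le.mpr ?_)
      refine Finset.card_lt_card ?_
      rw [Finset.ssubset_iff_of_subset]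
      · exact ⟨j, by simpa using hj, by simp [div_mul_cancel₀ _ hj]⟩
      · intro i
        simp only [Finset.mem_filter, Finset.mem_univ, true_and]
        intro hi hci
        apply hi
        have : x i = 0 := congrFun hx0 ⟨i, hci⟩
        simp [hci, this]
    have hdim : Module.finrank F (C.map ρ) = k := by
      have h1 := LinearMap.finrank_range_add_finrank_ker (ρ.domRestrict C)
      have h2 : Module.finrank F (LinearMap.ker (ρ.domRestrict C)) = 1 := by
        refine (finrank_eq_one_iff_of_nonzero'
          (⟨⟨c, hcC⟩, hρc⟩ : LinearMap.ker (ρ.domRestrict C)) ?_).mpr ?_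
        · intro h
          exact hc0 (congrArg (fun z : LinearMap.ker (ρ.domRestrict C) => (z : ι → F)) h)
        · rintro ⟨⟨x, hx⟩, hx0⟩
          obtain ⟨a, ha⟩ := hker x hx hx0
          exact ⟨a, by ext1; ext1; exact ha⟩
      rw [LinearMap.range_domRestrict] at h1
      omega
    have hq0 : (0 : ℚ) < Fintype.card F := by exact_mod_cast Fintype.card_pos
    -- The q words x - a c are nonzero, so each weighs at least as much as c; averaging over a gives
    -- the bound. A rational δ lets the induction divide by q without rounding.
    have hres : ∀ y ∈ C.map ρ, y ≠ 0 → δ / Fintype.card F ≤ hammingNorm y := by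
      rintro _ ⟨x, hx, rfl⟩ hy
      have hsum : Fintype.card F * hammingNorm c ≤ ∑ a : F, hammingNorm (x - a • c) := by
        rw [← smul_eq_mul, ← Finset.card_univ, ← Finset.sum_const]
        refine Finset.sum_le_sum fun a _ => hmin _ ⟨C.sub_mem hx (C.smul_mem _ hcC), ?_⟩
        intro h
        apply hy
        rw [sub_eq_zero.mp h, map_smul, hρc, smul_zero]
      rw [sum_hammingNorm_sub_smul] at hsum
      change _ ≤ _ + _ * hammingNorm (ρ x) at hsum
      have hge : hammingNorm c ≤ Fintype.card F * hammingNorm (ρ x) := by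
        obtain ⟨r, hr⟩ : ∃ r, Fintype.card F = r + 1 :=
          ⟨Fintype.card F - 1, (Nat.succ_pred_eq_of_pos Fintype.card_pos).symm⟩
        rw [hr] at hsum ⊢
        simp only [Nat.add_sub_cancel] at hsum
        linarith
      rw [div_le_iff₀ hq0]
      refine (hδ c hcC hc0).trans ?_
      rw [mul_comm]
      exact_mod_cast hge
    have hind := ih (C.map ρ) (δ / Fintype.card F) hdim hres
    rw [Finset.sum_range_succ']
    have hcard : Fintype.card {i // c i = 0} + hammingNorm c = Fintype.card ι := by
      rw [Fintype.card_subtype, hammingNorm]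
      exact Finset.card_filter_add_card_filter_not _
    have hfirst : ⌈δ / (Fintype.card F : ℚ) ^ 0⌉₊ ≤ hammingNorm c := by
      rw [pow_zero, div_one]
      exact Nat.ceil_le.mpr (hδ c hcC hc0)
    have hshift : ∑ i ∈ Finset.range k, ⌈δ / (Fintype.card F : ℚ) ^ (i + 1)⌉₊ =
        ∑ i ∈ Finset.range k, ⌈δ / Fintype.card F / (Fintype.card F : ℚ) ^ i⌉₊ :=
      Finset.sum_congr rfl fun i _ => by rw [pow_succ', div_div]
    omega

/-- The term i = 0 of the Griesmer sum is d itself, the others are monotone in d, and each extra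
dimension adds at least 1 because d > 0. -/
theorem HasParams.isOptimal_of_meetsGriesmer {ι : Type*} [Fintype ι] {C : Submodule F (ι → F)}
    {n k d : ℕ} (h : HasParams C n k d) (hG : MeetsGriesmer (Fintype.card F) n k d)
    (hk : 0 < k) (hd : 0 < d) : IsOptimal C n k d := by
  refine ⟨h, fun n' k' d' C' h' hn hk' hd' => ?_⟩
  obtain ⟨hn1, hk1, hd1⟩ := h'
  have hb := griesmer_bound k' C' (d' : ℚ) hk1 fun c hc h0 => by
    exact_mod_cast hd1.le_hammingNorm hc h0
  rw [Fintype.card_fin] at hb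
  have hq0 : (0 : ℚ) < Fintype.card F := by exact_mod_cast Fintype.card_pos
  obtain ⟨s, rfl⟩ := Nat.exists_eq_add_of_le hk'
  obtain ⟨t, rfl⟩ := Nat.exists_eq_succ_of_ne_zero hk.ne'
  rw [Finset.sum_range_add, Finset.sum_range_succ'] at hb
  rw [MeetsGriesmer, Finset.sum_range_succ'] at hG
  have h1 : ∑ i ∈ Finset.range t, ⌈(d : ℚ) / (Fintype.card F : ℚ) ^ (i + 1)⌉₊ ≤
      ∑ i ∈ Finset.range t, ⌈(d' : ℚ) / (Fintype.card F : ℚ) ^ (i + 1)⌉₊ := by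
    refine Finset.sum_le_sum fun i _ => Nat.ceil_mono ?_
    gcongr
  have h2 : s ≤ ∑ i ∈ Finset.range s, ⌈(d' : ℚ) / (Fintype.card F : ℚ) ^ (t.succ + i)⌉₊ := by
    calc s = ∑ i ∈ Finset.range s, 1 := by simp
      _ ≤ _ := Finset.sum_le_sum fun i _ => Nat.one_le_ceil_iff.mpr (by
          have : (0 : ℚ) < d' := by exact_mod_cast hd.trans_le hd'
          positivity)
  simp only [pow_zero, div_one, Nat.ceil_natCast] at hb hG
  omega

end CodeBounds

/-! ### Weight enumerators of codes with one or two weights. -/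

section WeightEnumerators

variable {F : Type*} [Field F] [DecidableEq F] {ι : Type*} [Fintype ι] {C : Submodule F (ι → F)}

theorem weightCount_zero : weightCount C 0 = 1 := by
  rw [weightCount, Set.ncard_eq_one]
  refine ⟨0, ?_⟩
  ext c
  simp only [Set.mem_ofPred_eq, hammingNorm_eq_zero, Set.mem_singleton_iff]
  constructor
  · exact fun h => h.2
  · rintro rfl
    exact ⟨C.zero_mem, rfl⟩

theorem weightCount_eq_zero {w : ℕ} (h : ∀ c ∈ C, hammingNorm c ≠ w) : weightCount C w = 0 := by
  have : {c : ι → F | c ∈ C ∧ hammingNorm c = w} = ∅ :=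
    Set.eq_empty_of_forall_notMem fun c hc => h c hc.1 hc.2
  rw [weightCount, this, Set.ncard_empty]

theorem weightCount_eq_zero_of_card_lt {w : ℕ} (h : Fintype.card ι < w) : weightCount C w = 0 :=
  weightCount_eq_zero fun _ _ hw => absurd (hw ▸ hammingNorm_le_card_fintype) (not_le.mpr h)

theorem weightEnumerator_eq_sum {s : Finset ℕ} (hs : ∀ c ∈ C, hammingNorm c ∈ s) :
    weightEnumerator C =
      ∑ w ∈ s, Polynomial.C (weightCount C w : ℤ) * Polynomial.X ^ w := by
  rw [weightEnumerator]
  rw [Finset.sum_subset (Finset.subset_union_left (s₂ := s)),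
    ← Finset.sum_subset (Finset.subset_union_right (s₁ := Finset.range (Fintype.card ι + 1)))]
  · intro w _ hw
    rw [weightCount_eq_zero (w := w) fun c hc h => hw (h ▸ hs c hc)]
    simp
  · intro w _ hw
    rw [weightCount_eq_zero_of_card_lt (by simpa using hw)]
    simp

theorem isWeightCode_card {s : Finset ℕ} (hs : ∀ c ∈ C, c ≠ 0 → hammingNorm c ∈ s)
    (h0 : 0 ∉ s) (hne : ∀ w ∈ s, weightCount C w ≠ 0) : IsWeightCode C s.card := by
  rw [IsWeightCode]
  congr 1
  ext w
  simp only [Finset.mem_filter, Finset.mem_Icc]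
  constructor
  · rintro ⟨⟨h1, -⟩, hw⟩
    by_contra hws
    refine hw (weightCount_eq_zero fun c hc h => ?_)
    refine hws (h ▸ hs c hc ?_)
    rintro rfl
    simp at h
    omega
  · intro hw
    refine ⟨⟨Nat.one_le_iff_ne_zero.mpr fun h => h0 (h ▸ hw), ?_⟩, hne w hw⟩
    by_contra hlt
    exact hne w hw (weightCount_eq_zero_of_card_lt (not_le.mp hlt))

theorem sum_weightCount [Fintype F] {s : Finset ℕ} (hs : ∀ c ∈ C, hammingNorm c ∈ s) :
    ∑ w ∈ s, weightCount C w = Fintype.card F ^ Module.finrank F C := by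
  classical
  rw [← Module.card_eq_pow_finrank (K := F) (V := C), Fintype.card_subtype,
    Finset.card_eq_sum_card_fiberwise (f := fun c : ι → F => hammingNorm c) (t := s)]
  · refine Finset.sum_congr rfl fun w _ => ?_
    rw [weightCount, ← Set.ncard_coe_finset]
    congr 1
    ext c
    simp
  · intro c hc
    exact hs c (by simpa using hc)

theorem weightEnumerator_of_one_weight [Fintype F] {k d : ℕ} (hk : Module.finrank F C = k)
    (hk0 : 0 < k) (hd : 0 < d) (hw : ∀ c ∈ C, c ≠ 0 → hammingNorm c = d) :
    IsWeightCode C 1 ∧ weightEnumerator C =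
      1 + Polynomial.C ((Fintype.card F : ℤ) ^ k - 1) * Polynomial.X ^ d := by
  have hs : ∀ c ∈ C, hammingNorm c ∈ ({0, d} : Finset ℕ) := by
    intro c hc
    by_cases h0 : c = 0
    · simp [h0]
    · simp [hw c hc h0]
  have hsum := sum_weightCount hs
  rw [Finset.sum_pair hd.ne, weightCount_zero, hk] at hsum
  have hgt : 1 < Fintype.card F ^ k := Nat.one_lt_pow hk0.ne' Fintype.one_lt_card
  constructor
  · refine isWeightCode_card (s := {d}) (fun c hc h0 => by simp [hw c hc h0])
      (by simpa using hd.ne) ?_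
    simp only [Finset.mem_singleton, forall_eq]
    omega
  · rw [weightEnumerator_eq_sum hs, Finset.sum_pair hd.ne, weightCount_zero,
      show (weightCount C d : ℤ) = (Fintype.card F : ℤ) ^ k - 1 by
        rw [eq_sub_iff_add_eq']
        exact_mod_cast hsum]
    simp

/-- Only the words of weight d₂ need counting: the total q^k determines the other coefficient. -/
theorem weightEnumerator_of_two_weight [Fintype F] {k d₁ d₂ b : ℕ}
    (hk : Module.finrank F C = k) (hd₁ : 0 < d₁) (hlt : d₁ < d₂)
    (hw : ∀ c ∈ C, c ≠ 0 → hammingNorm c = d₁ ∨ hammingNorm c = d₂)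
    (hb : weightCount C d₂ = b) (hb0 : 0 < b) (hlt' : b + 1 < Fintype.card F ^ k) :
    IsWeightCode C 2 ∧ weightEnumerator C =
      1 + Polynomial.C ((Fintype.card F : ℤ) ^ k - 1 - b) * Polynomial.X ^ d₁ +
        Polynomial.C (b : ℤ) * Polynomial.X ^ d₂ ∧ weightCount C d₁ ≠ 0 := by
  have hs : ∀ c ∈ C, hammingNorm c ∈ ({0, d₁, d₂} : Finset ℕ) := by
    intro c hc
    by_cases h0 : c = 0
    · simp [h0]
    · rcases hw c hc h0 with h | h <;> simp [h]
  have hn : (0 : ℕ) ∉ ({d₁, d₂} : Finset ℕ) := by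
    simp
    omega
  have hsum := sum_weightCount hs
  rw [Finset.sum_insert hn, Finset.sum_pair hlt.ne, weightCount_zero, hk, hb] at hsum
  have hne : weightCount C d₁ ≠ 0 := by omega
  refine ⟨?_, ?_, hne⟩
  · have := isWeightCode_card (C := C) (s := {d₁, d₂})
      (fun c hc h0 => by rcases hw c hc h0 with h | h <;> simp [h]) hn (by
        simp only [Finset.mem_insert, Finset.mem_singleton, forall_eq_or_imp, forall_eq]
        exact ⟨hne, by omega⟩)
    rwa [Finset.card_pair hlt.ne] at this
  · rw [weightEnumerator_eq_sum hs, Finset.sum_insert hn, Finset.sum_pair hlt.ne,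
      weightCount_zero, hb,
      show (weightCount C d₁ : ℤ) = (Fintype.card F : ℤ) ^ k - 1 - b by
        rw [eq_sub_iff_add_eq, eq_sub_iff_add_eq']
        exact_mod_cast hsum]
    simp [add_assoc]

end WeightEnumerators

end FewWeight

namespace FewWeight

/-! ### Counting zeros of functionals on cosets. -/

section LinearFibres

variable {F V V' : Type*} [Field F] [AddCommGroup V] [Module F V]
  [AddCommGroup V'] [Module F V']

theorem finrank_ker_inf_ker [FiniteDimensional F V] (g : V →ₗ[F] V') (f : V →ₗ[F] F)
    (h : ∃ w, g w = 0 ∧ f w ≠ 0) :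
    Module.finrank F (LinearMap.ker (g.prod f)) + 1 = Module.finrank F (LinearMap.ker g) := by
  obtain ⟨w, hw, hfw⟩ := h
  have h1 := LinearMap.finrank_range_add_finrank_ker (f.domRestrict (LinearMap.ker g))
  have h2 : LinearMap.range (f.domRestrict (LinearMap.ker g)) = ⊤ :=
    LinearMap.range_eq_top.mpr (LinearMap.surjective fun h0 =>
      hfw (LinearMap.congr_fun h0 (⟨w, hw⟩ : LinearMap.ker g)))
  have h3 : Module.finrank F (LinearMap.ker (f.domRestrict (LinearMap.ker g))) =
      Module.finrank F (LinearMap.ker (g.prod f)) := by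
    rw [LinearMap.ker_prod, ← Submodule.map_comap_subtype,
      Submodule.finrank_map_subtype_eq]
    rfl
  rw [h2, finrank_top, Module.finrank_self] at h1
  omega

variable [Fintype F] [Fintype V] [DecidableEq V']

theorem card_fibre (g : V →ₗ[F] V') (z : V) :
    (Finset.univ.filter fun x => g x = g z).card =
      Fintype.card F ^ Module.finrank F (LinearMap.ker g) := by
  classical
  rw [← Module.card_eq_pow_finrank (K := F) (V := LinearMap.ker g), Fintype.card_subtype]
  refine Finset.card_bij' (fun x _ => x - z) (fun x _ => x + z) ?_ ?_ ?_ ?_ <;>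
    simp [sub_eq_zero]

theorem card_fibre_and_eq_zero [DecidableEq F] (g : V →ₗ[F] V')
    (f : V →ₗ[F] F) (h : ∃ w, g w = 0 ∧ f w ≠ 0) (z : V) :
    (Finset.univ.filter fun x => g x = g z ∧ f x = 0).card =
      Fintype.card F ^ (Module.finrank F (LinearMap.ker g) - 1) := by
  have hr := finrank_ker_inf_ker g f h
  obtain ⟨w, hw, hfw⟩ := h
  -- Moving z along w stays in its g-fibre and reaches a zero of f, so the set is a fibre of the
  -- pair (g, f).
  rw [← hr, Nat.add_sub_cancel, ← card_fibre (g.prod f) (z - (f z / f w) • w)]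
  congr 1
  ext x
  simp [hw, div_mul_cancel₀ _ hfw]

/-- On each coset of `ker g`, a functional not vanishing on `ker g` has the same number of
nonzeros. -/
theorem card_fibre_and_ne_zero [DecidableEq F] (g : V →ₗ[F] V')
    (f : V →ₗ[F] F) (h : ∃ w, g w = 0 ∧ f w ≠ 0) (z : V) :
    (Finset.univ.filter fun x => g x = g z ∧ f x ≠ 0).card =
      Fintype.card F ^ Module.finrank F (LinearMap.ker g) -
        Fintype.card F ^ (Module.finrank F (LinearMap.ker g) - 1) := by
  rw [← card_fibre g z, ← card_fibre_and_eq_zero g f h z, ← Finset.filter_filter,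
    ← Finset.filter_filter]
  have := Finset.card_filter_add_card_filter_not
    (s := Finset.univ.filter fun x => g x = g z) (fun x => f x = 0)
  refine Nat.eq_sub_of_add_eq' ?_
  convert this

end LinearFibres

/-! ### Trace codes: weights and dimension. -/

section TraceCodes

variable {F K : Type*} [Field F] [Field K] [Algebra F K]

/-- The functional `x ↦ Tr (b * x)`. -/
noncomputable def traceMul (b : K) : K →ₗ[F] F := Algebra.traceForm F K b

theorem traceMul_apply (b x : K) : traceMul b x = Algebra.trace F K (b * x) := rfl

theorem mem_traceCode {D : Finset K} {c : D → F} :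
    c ∈ traceCode F D ↔ ∃ b : K, c = fun d : D => traceMul b (d : K) := by
  rw [traceCode, LinearMap.mem_range]
  exact exists_congr fun b => eq_comm

theorem hammingNorm_traceMul [DecidableEq F] (D : Finset K) (b : K) :
    hammingNorm (fun d : D => (traceMul b (d : K) : F)) =
      (D.filter fun x => (traceMul b x : F) ≠ 0).card := by
  rw [hammingNorm, ← Finset.card_map (Function.Embedding.subtype _)]
  congr 1
  ext x
  simp
  tauto

/-- The word of b is zero exactly when b is orthogonal to the span of D under the trace form, which
is nondegenerate. -/
theorem finrank_traceCode [FiniteDimensional F K] [Algebra.IsSeparable F K] (D : Finset K) :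
    Module.finrank F (traceCode F D) = Module.finrank F (Submodule.span F (D : Set K)) := by
  have h1 := LinearMap.finrank_range_add_finrank_ker
    (LinearMap.pi fun d : D => Algebra.trace F K ∘ₗ LinearMap.mulRight F (d : K))
  have h2 : LinearMap.ker
      (LinearMap.pi fun d : D => Algebra.trace F K ∘ₗ LinearMap.mulRight F (d : K)) =
        (Algebra.traceForm F K).orthogonal (Submodule.span F (D : Set K)) := by
    ext b
    rw [LinearMap.mem_ker, LinearMap.BilinForm.mem_orthogonal_iff]
    constructor
    · intro h n hn
      induction hn using Submodule.span_induction with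
      | mem x hx =>
        change Algebra.trace F K (x * b) = 0
        rw [mul_comm]
        exact congrFun h ⟨x, hx⟩
      | zero => simp
      | add x y _ _ hx hy =>
        change Algebra.traceForm F K (x + y) b = 0
        rw [map_add, LinearMap.add_apply, show Algebra.traceForm F K x b = 0 from hx,
          show Algebra.traceForm F K y b = 0 from hy, add_zero]
      | smul a x _ hx =>
        change Algebra.traceForm F K (a • x) b = 0
        rw [map_smul, LinearMap.smul_apply, show Algebra.traceForm F K x b = 0 from hx, smul_zero]
    · intro h
      ext d
      have : Algebra.trace F K (d * b) = 0 := h d (Submodule.subset_span d.2)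
      rwa [mul_comm] at this
  rw [h2, LinearMap.BilinForm.finrank_orthogonal (traceForm_nondegenerate F K)] at h1
  have h3 := Submodule.finrank_le (Submodule.span F (D : Set K))
  change Module.finrank F (traceCode F D) + _ = _ at h1
  omega

end TraceCodes

/-! ### The map L and the trace forms in degree 4. -/

section QuarticExtension

variable {F K : Type*} [Field F] [Fintype F] [Field K] [Algebra F K]

variable (F K) in
/-- The map `x ↦ x + x ^ (q ^ 2)`, for `q = |F|`. -/
noncomputable def addFrobSq : K →ₗ[F] K :=
  LinearMap.id + (FiniteField.frobeniusAlgHom F K ^ 2).toLinearMap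

theorem addFrobSq_apply (x : K) : addFrobSq F K x = x + x ^ Fintype.card F ^ 2 := by
  simp [addFrobSq, pow_two, pow_mul]

theorem add_pow_card (x y : K) :
    (x + y) ^ Fintype.card F = x ^ Fintype.card F + y ^ Fintype.card F :=
  map_add (FiniteField.frobeniusAlgHom F K) x y

variable [Fintype K]

theorem pow_card_pow_four (hK : Module.finrank F K = 4) (x : K) :
    x ^ Fintype.card F ^ 4 = x := by
  rw [← hK, ← Module.card_eq_pow_finrank, FiniteField.pow_card]

/-- W lies among the at most q^2 roots of X^(q^2) - aX. -/
theorem finrank_le_two_of_pow_eq (W : Submodule F K) (a : K)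
    (h : ∀ x ∈ W, x ^ Fintype.card F ^ 2 = a * x) : Module.finrank F W ≤ 2 := by
  classical
  have hq : 1 < Fintype.card F := Fintype.one_lt_card
  have hq2 : 1 < Fintype.card F ^ 2 := Nat.one_lt_pow two_ne_zero hq
  set P : Polynomial K := Polynomial.X ^ Fintype.card F ^ 2 - Polynomial.C a * Polynomial.X
  have hdeg : P.natDegree = Fintype.card F ^ 2 := by
    rw [Polynomial.natDegree_sub_eq_left_of_natDegree_lt] <;> rw [Polynomial.natDegree_X_pow]
    exact (Polynomial.natDegree_C_mul_le a _).trans_lt (Polynomial.natDegree_X_le.trans_lt hq2)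
  have hP : P ≠ 0 := by
    intro h0
    rw [h0, Polynomial.natDegree_zero] at hdeg
    omega
  have hcard := Polynomial.card_le_degree_of_subset_roots (p := P)
    (Z := Finset.univ.filter fun x => x ∈ W) fun x hx => by
      rw [Polynomial.mem_roots hP]
      simp [P, h x (by simpa using hx)]
  rw [hdeg, ← Fintype.card_subtype, Module.card_eq_pow_finrank (K := F)] at hcard
  exact (Nat.pow_le_pow_iff_right hq).mp hcard

/-- The q^2-power map is -1 on the kernel and +1 on the range of L. Both dimensions are thus at most
2, and they add up to 4. -/
theorem finrank_ker_addFrobSq (hK : Module.finrank F K = 4) :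
    Module.finrank F (LinearMap.ker (addFrobSq F K)) = 2 := by
  have hle : Module.finrank F (LinearMap.ker (addFrobSq F K)) ≤ 2 := by
    refine finrank_le_two_of_pow_eq _ (-1) fun x hx => ?_
    rw [LinearMap.mem_ker, addFrobSq_apply] at hx
    linear_combination hx
  have hle' : Module.finrank F (LinearMap.range (addFrobSq F K)) ≤ 2 := by
    refine finrank_le_two_of_pow_eq _ 1 ?_
    rintro _ ⟨x, rfl⟩
    have h4 := pow_card_pow_four hK x
    have : x ^ Fintype.card F ^ 4 = ((((x ^ Fintype.card F) ^ Fintype.card F) ^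
        Fintype.card F) ^ Fintype.card F) := by ring
    rw [this] at h4
    simp only [addFrobSq_apply, pow_two, pow_mul, add_pow_card, h4]
    ring
  have := LinearMap.finrank_range_add_finrank_ker (addFrobSq F K)
  omega

theorem algebraMap_trace (hK : Module.finrank F K = 4) (x : K) :
    algebraMap F K (Algebra.trace F K x) =
      addFrobSq F K x + addFrobSq F K x ^ Fintype.card F := by
  rw [FiniteField.algebraMap_trace_eq_sum_pow, hK, Nat.card_eq_fintype_card]
  simp only [Finset.sum_range_succ, Finset.sum_range_zero, addFrobSq_apply, add_pow_card,
    ← pow_mul, ← pow_succ]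
  simp
  ring

theorem trace_eq_zero_iff (hK : Module.finrank F K = 4) (x : K) :
    Algebra.trace F K x = 0 ↔ addFrobSq F K x ^ Fintype.card F = -addFrobSq F K x := by
  rw [← map_eq_zero (algebraMap F K), algebraMap_trace hK, eq_neg_iff_add_eq_zero, add_comm]

theorem pow_card_pow_of_odd (hK : Module.finrank F K = 4) {e : ℕ} (he : Odd e) (x : K) :
    x ^ Fintype.card F ^ e = x ^ Fintype.card F ∨
      x ^ Fintype.card F ^ e = x ^ Fintype.card F ^ 3 := by
  have hper : ∀ k r, x ^ Fintype.card F ^ (4 * k + r) = x ^ Fintype.card F ^ r := by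
    intro k r
    induction k with
    | zero => simp
    | succ k ih =>
      rw [show 4 * (k + 1) + r = 4 + (4 * k + r) by ring, pow_add, pow_mul,
        pow_card_pow_four hK, ih]
  obtain ⟨t, rfl⟩ := he
  obtain ⟨s, rfl | rfl⟩ := Nat.even_or_odd' t
  · left
    rw [show 2 * (2 * s) + 1 = 4 * s + 1 by ring, hper, pow_one]
  · right
    rw [show 2 * (2 * s + 1) + 1 = 4 * s + 3 by ring, hper]

/-- For odd `e`, the form `Tr (x ^ (q ^ e + 1))` is the norm of `x + x ^ (q ^ 2)` from the quadratic
subextension. -/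
theorem algebraMap_trace_pow (hK : Module.finrank F K = 4) {e : ℕ} (he : Odd e) (x : K) :
    algebraMap F K (Algebra.trace F K (x ^ (Fintype.card F ^ e + 1))) =
      addFrobSq F K x ^ Fintype.card F * addFrobSq F K x := by
  have h4 := pow_card_pow_four hK x
  rw [FiniteField.algebraMap_trace_eq_sum_pow, hK, Nat.card_eq_fintype_card, pow_succ]
  have e2 : Fintype.card F ^ 2 = Fintype.card F * Fintype.card F := by ring
  have e3 : Fintype.card F ^ 3 = Fintype.card F * Fintype.card F * Fintype.card F := by ring
  have e4 : Fintype.card F ^ 4 =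
    Fintype.card F * Fintype.card F * Fintype.card F * Fintype.card F := by ring
  rw [e4] at h4
  simp only [pow_mul] at h4
  -- With x_i = x^(q^i), either residue of e mod 4 yields the four products of cyclically adjacent
  -- x_i, whose sum is (x_0 + x_2)(x_1 + x_3).
  rcases pow_card_pow_of_odd hK he x with h | h <;> rw [h] <;>
    simp only [Finset.sum_range_succ, Finset.sum_range_zero, addFrobSq_apply, e2, e3, pow_mul,
      add_pow_card, mul_pow, pow_zero, pow_one, h4] <;> ring

theorem algebraMap_trace_pow_of_trace_eq_zero (hK : Module.finrank F K = 4) {e : ℕ} (he : Odd e)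
    {x : K} (hx : Algebra.trace F K x = 0) :
    algebraMap F K (Algebra.trace F K (x ^ (Fintype.card F ^ e + 1))) =
      -addFrobSq F K x ^ 2 := by
  rw [algebraMap_trace_pow hK he, (trace_eq_zero_iff hK x).mp hx]
  ring

theorem trace_eq_zero_of_addFrobSq_eq_zero (hK : Module.finrank F K = 4) {x : K}
    (hx : addFrobSq F K x = 0) : Algebra.trace F K x = 0 := by
  rw [trace_eq_zero_iff hK, hx, neg_zero, zero_pow Fintype.card_ne_zero]

theorem mem_definingSet [DecidableEq F] [DecidableEq K] (hK : Module.finrank F K = 4) {e : ℕ}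
    (he : Odd e) {u : F} {x : K} :
    x ∈ definingSet F K e u 0 ↔
      x ≠ 0 ∧ addFrobSq F K x ^ 2 = -algebraMap F K u ∧ Algebra.trace F K x = 0 := by
  rw [definingSet, Finset.mem_filter]
  simp only [Finset.mem_univ, true_and]
  refine and_congr_right fun _ => and_congr_left fun hx => ?_
  rw [← (algebraMap F K).injective.eq_iff, algebraMap_trace_pow_of_trace_eq_zero hK he hx,
    neg_eq_iff_eq_neg]

theorem finrank_ker_trace (hK : Module.finrank F K = 4) :
    Module.finrank F (LinearMap.ker (Algebra.trace F K)) = 3 := by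
  have h := LinearMap.finrank_range_add_finrank_ker (Algebra.trace F K)
  rw [LinearMap.range_eq_top.mpr (Algebra.trace_surjective F K), finrank_top,
    Module.finrank_self] at h
  omega

end QuarticExtension

end FewWeight

namespace FewWeight

section QuarticCodes

variable {F K : Type*} [Field F] [Fintype F] [DecidableEq F] [Field K] [Fintype K] [DecidableEq K]
  [Algebra F K]

omit [DecidableEq F] in
theorem two_lt_card (hchar : ringChar F ≠ 2) : 2 < Fintype.card F := by
  have h1 : 1 < Fintype.card F := Fintype.one_lt_card
  have h2 := FiniteField.odd_card_of_char_ne_two hchar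
  omega

omit [Fintype F] [DecidableEq F] [Fintype K] [DecidableEq K] in
theorem two_ne_zero_of_algebra (hchar : ringChar F ≠ 2) : (2 : K) ≠ 0 := fun h =>
  Ring.two_ne_zero hchar ((algebraMap F K).injective (by rw [map_ofNat, map_zero, h]))

/-! ### The case u = 0. -/

section UZero

variable (hK : Module.finrank F K = 4) {e : ℕ} (he : Odd e)
include hK he

theorem definingSet_zero :
    definingSet F K e 0 0 =
      (Finset.univ.filter fun x => addFrobSq F K x = addFrobSq F K 0).erase 0 := by
  ext x
  rw [mem_definingSet hK he, Finset.mem_erase, Finset.mem_filter]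
  simp only [map_zero, neg_zero, Finset.mem_univ, true_and, sq_eq_zero_iff]
  exact and_congr_right fun _ => ⟨fun h => h.1,
    fun h => ⟨h, trace_eq_zero_of_addFrobSq_eq_zero hK h⟩⟩

theorem card_definingSet_zero : (definingSet F K e 0 0).card = Fintype.card F ^ 2 - 1 := by
  rw [definingSet_zero hK he, Finset.card_erase_of_mem (by simp), card_fibre,
    finrank_ker_addFrobSq hK]

theorem finrank_traceCode_zero :
    Module.finrank F (traceCode F (definingSet F K e 0 0)) = 2 := by
  have hspan : Submodule.span F (definingSet F K e 0 0 : Set K) =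
      LinearMap.ker (addFrobSq F K) := by
    apply le_antisymm
    · rw [Submodule.span_le]
      intro x hx
      rw [Finset.mem_coe, definingSet_zero hK he] at hx
      simpa using (Finset.mem_erase.mp hx).2
    · intro x hx
      by_cases h0 : x = 0
      · rw [h0]
        exact Submodule.zero_mem _
      · apply Submodule.subset_span
        rw [Finset.mem_coe, definingSet_zero hK he]
        simpa [h0] using hx
  rw [finrank_traceCode, hspan, finrank_ker_addFrobSq hK]

theorem hammingNorm_traceCode_zero {c : definingSet F K e 0 0 → F}
    (hc : c ∈ traceCode F (definingSet F K e 0 0)) (h0 : c ≠ 0) :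
    hammingNorm c = Fintype.card F ^ 2 - Fintype.card F := by
  obtain ⟨b, rfl⟩ := mem_traceCode.mp hc
  obtain ⟨⟨w, hw⟩, hbw⟩ := Function.ne_iff.mp h0
  have hw' : addFrobSq F K w = 0 := by
    rw [definingSet_zero hK he] at hw
    simpa using (Finset.mem_erase.mp hw).2
  have hcard := card_fibre_and_ne_zero (addFrobSq F K) (traceMul b) ⟨w, hw', hbw⟩ 0
  rw [finrank_ker_addFrobSq hK] at hcard
  rw [hammingNorm_traceMul, definingSet_zero hK he]
  simp only [Nat.add_one_sub_one, pow_one] at hcard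
  rw [← hcard]
  congr 1
  ext x
  simp only [Finset.mem_filter, Finset.mem_erase, Finset.mem_univ, true_and]
  constructor
  · rintro ⟨⟨-, h⟩, h'⟩
    exact ⟨h, h'⟩
  -- Removing 0 from ker L loses no nonzero of the functional.
  · rintro ⟨h, h'⟩
    refine ⟨⟨?_, h⟩, h'⟩
    rintro rfl
    exact h' (map_zero _)

end UZero

/-- Since dim ker Tr = 3 > 2 = dim ker L, some trace-zero z has L(z) ≠ 0. Its square g lies in F but
is a nonsquare there: otherwise L(z) would be in F, against L(z)^q = -L(z). Two nonsquares differ by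
a square factor, so a scalar multiple of z works. -/
theorem exists_addFrobSq_sq_eq (hchar : ringChar F ≠ 2) (hK : Module.finrank F K = 4) {v : F}
    (hv : ¬ IsSquare v) :
    ∃ x : K, Algebra.trace F K x = 0 ∧ addFrobSq F K x ^ 2 = algebraMap F K v := by
  obtain ⟨z, hz, hLz⟩ : ∃ z : K, Algebra.trace F K z = 0 ∧ addFrobSq F K z ≠ 0 := by
    by_contra! h
    have hle : LinearMap.ker (Algebra.trace F K) ≤ LinearMap.ker (addFrobSq F K) :=
      fun z hz => h z hz
    have := Submodule.finrank_mono hle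
    rw [finrank_ker_trace hK, finrank_ker_addFrobSq hK] at this
    omega
  obtain ⟨g, hg⟩ : ∃ g : F, addFrobSq F K z ^ 2 = algebraMap F K g := by
    refine ⟨-Algebra.trace F K (z ^ (Fintype.card F ^ 1 + 1)), ?_⟩
    rw [map_neg, algebraMap_trace_pow_of_trace_eq_zero hK odd_one hz, neg_neg]
  have hgsq : ¬ IsSquare g := by
    rintro ⟨r, rfl⟩
    have hz' := (trace_eq_zero_iff hK z).mp hz
    have : (addFrobSq F K z - algebraMap F K r) * (addFrobSq F K z + algebraMap F K r) = 0 := by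
      rw [map_mul] at hg
      linear_combination hg
    have hfix : addFrobSq F K z ^ Fintype.card F = addFrobSq F K z := by
      rcases mul_eq_zero.mp this with h | h
      · rw [sub_eq_zero.mp h, ← map_pow, FiniteField.pow_card]
      · rw [eq_neg_of_add_eq_zero_left h, ← map_neg, ← map_pow, FiniteField.pow_card]
    rw [hfix, eq_neg_iff_add_eq_zero, ← two_mul] at hz'
    exact (mul_ne_zero (two_ne_zero_of_algebra hchar) hLz) hz'
  have hg0 : g ≠ 0 := by
    rintro rfl
    exact hgsq IsSquare.zero
  have hv0 : v ≠ 0 := by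
    rintro rfl
    exact hv IsSquare.zero
  obtain ⟨r, hr⟩ : IsSquare (v * g) := by
    rw [← quadraticChar_one_iff_isSquare (mul_ne_zero hv0 hg0), map_mul,
      quadraticChar_neg_one_iff_not_isSquare.mpr hv,
      quadraticChar_neg_one_iff_not_isSquare.mpr hgsq]
    norm_num
  -- With r^2 = vg, the scaling turns g into (r/g)^2 g = v.
  refine ⟨(r / g) • z, by rw [map_smul, hz, smul_zero], ?_⟩
  rw [map_smul, Algebra.smul_def, mul_pow, hg, ← map_pow, ← map_mul]
  congr 1
  field_simp
  linear_combination -hr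

/-! ### The case u ≠ 0: two opposite cosets of ker L. -/

section UNeZero

variable (hchar : ringChar F ≠ 2) (hK : Module.finrank F K = 4) {e : ℕ} (he : Odd e)
  {u : F} (hu : u ≠ 0) {z : K} (hz : Algebra.trace F K z = 0)
  (hLz : addFrobSq F K z ^ 2 = -algebraMap F K u)
include hK he hu hz hLz

omit [DecidableEq F] [DecidableEq K] [Fintype K] hK he hz in
theorem addFrobSq_ne_zero_of_sq_eq : addFrobSq F K z ≠ 0 := by
  intro h
  rw [h, zero_pow two_ne_zero, eq_comm, neg_eq_zero, map_eq_zero] at hLz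
  exact hu hLz

theorem definingSet_eq_union :
    definingSet F K e u 0 =
      (Finset.univ.filter fun x => addFrobSq F K x = addFrobSq F K z) ∪
        Finset.univ.filter fun x => addFrobSq F K x = addFrobSq F K (-z) := by
  have h0 := addFrobSq_ne_zero_of_sq_eq hu hLz
  ext x
  rw [mem_definingSet hK he, Finset.mem_union, Finset.mem_filter, Finset.mem_filter, ← hLz,
    sq_eq_sq_iff_eq_or_eq_neg, map_neg]
  simp only [Finset.mem_univ, true_and]
  constructor
  · exact fun h => h.2.1
  · intro h
    refine ⟨?_, h, ?_⟩
    · rintro rfl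
      rw [map_zero, zero_eq_neg] at h
      rcases h with h | h
      · exact h0 h.symm
      · exact h0 h
    · have hz' := (trace_eq_zero_iff hK z).mp hz
      have hn := (trace_eq_zero_iff hK (-z)).mp (by rw [map_neg, hz, neg_zero])
      rw [map_neg] at hn
      rw [trace_eq_zero_iff hK]
      rcases h with h | h <;> rw [h]
      · exact hz'
      · exact hn

omit [Fintype K] [DecidableEq F] hK he hz in
include hchar in
theorem disjoint_fibres (s t : Finset K) :
    Disjoint (s.filter fun x => addFrobSq F K x = addFrobSq F K z)
      (t.filter fun x => addFrobSq F K x = addFrobSq F K (-z)) := by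
  have h0 := addFrobSq_ne_zero_of_sq_eq hu hLz
  rw [Finset.disjoint_left]
  intro x hx hx'
  rw [Finset.mem_filter] at hx hx'
  have h := hx.2.symm.trans hx'.2
  rw [map_neg, eq_neg_iff_add_eq_zero, ← two_mul] at h
  exact mul_ne_zero (two_ne_zero_of_algebra hchar) h0 h

include hchar in
theorem card_definingSet_of_ne_zero :
    (definingSet F K e u 0).card = 2 * Fintype.card F ^ 2 := by
  rw [definingSet_eq_union hK he hu hz hLz,
    Finset.card_union_of_disjoint (disjoint_fibres hchar hu hLz _ _), card_fibre, card_fibre,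
    finrank_ker_addFrobSq hK, two_mul]

/-- The set lies in the 3-dimensional ker Tr. Its span contains ker L, as differences (z + w) - z,
and also z outside ker L. -/
theorem finrank_traceCode_of_ne_zero :
    Module.finrank F (traceCode F (definingSet F K e u 0)) = 3 := by
  have hmem : ∀ {x : K}, x ∈ definingSet F K e u 0 ↔
      addFrobSq F K x = addFrobSq F K z ∨ addFrobSq F K x = addFrobSq F K (-z) := by
    intro x
    simp [definingSet_eq_union hK he hu hz hLz]
  rw [finrank_traceCode]
  apply le_antisymm
  · rw [← finrank_ker_trace hK]
    apply Submodule.finrank_mono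
    rw [Submodule.span_le]
    intro x hx
    exact ((mem_definingSet hK he).mp hx).2.2
  · rw [Nat.succ_le_iff, ← finrank_ker_addFrobSq hK]
    apply Submodule.finrank_lt_finrank_of_lt
    have hzs : z ∈ Submodule.span F (definingSet F K e u 0 : Set K) :=
      Submodule.subset_span (hmem.mpr (Or.inl rfl))
    rw [SetLike.lt_iff_le_and_exists]
    refine ⟨fun w hw => ?_, z, hzs, fun h => addFrobSq_ne_zero_of_sq_eq hu hLz h⟩
    have hwz : z + w ∈ Submodule.span F (definingSet F K e u 0 : Set K) :=
      Submodule.subset_span (hmem.mpr (Or.inl (by rw [map_add, LinearMap.mem_ker.mp hw, add_zero])))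
    simpa using Submodule.sub_mem _ hwz hzs

include hchar in
theorem hammingNorm_of_exists_ne_zero {b : K}
    (hb : ∃ w, addFrobSq F K w = 0 ∧ (traceMul b w : F) ≠ 0) :
    hammingNorm (fun d : definingSet F K e u 0 => (traceMul b (d : K) : F)) =
      2 * Fintype.card F ^ 2 - 2 * Fintype.card F := by
  have hcard := card_fibre_and_ne_zero (addFrobSq F K) (traceMul b) hb
  rw [finrank_ker_addFrobSq hK] at hcard
  simp only [Nat.add_one_sub_one, pow_one] at hcard
  rw [hammingNorm_traceMul, definingSet_eq_union hK he hu hz hLz, Finset.filter_union,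
    Finset.card_union_of_disjoint (Finset.disjoint_filter_filter
      (disjoint_fibres hchar hu hLz _ _)), Finset.filter_filter, Finset.filter_filter, hcard, hcard]
  omega

/-- A functional vanishing on ker L factors through L, so its word is fixed up to sign by its value
at z. -/
theorem traceMul_eq_or_eq_neg {b : K} (hb : ∀ w, addFrobSq F K w = 0 → (traceMul b w : F) = 0)
    {x : K} (hx : x ∈ definingSet F K e u 0) :
    addFrobSq F K x = addFrobSq F K z ∧ (traceMul b x : F) = traceMul b z ∨
      addFrobSq F K x = -addFrobSq F K z ∧ (traceMul b x : F) = -traceMul b z := by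
  rw [definingSet_eq_union hK he hu hz hLz, Finset.mem_union, Finset.mem_filter,
    Finset.mem_filter] at hx
  rcases hx with ⟨-, h⟩ | ⟨-, h⟩
  · left
    refine ⟨h, ?_⟩
    have := hb (x - z) (by rw [map_sub, h, sub_self])
    rwa [map_sub, sub_eq_zero] at this
  · right
    refine ⟨by rw [h, map_neg], ?_⟩
    have := hb (x - -z) (by rw [map_sub, h, sub_self])
    rwa [map_sub, sub_eq_zero, map_neg] at this

include hchar in
theorem hammingNorm_of_forall_eq_zero {b : K}
    (hb : ∀ w, addFrobSq F K w = 0 → (traceMul b w : F) = 0) (hbz : (traceMul b z : F) ≠ 0) :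
    hammingNorm (fun d : definingSet F K e u 0 => (traceMul b (d : K) : F)) =
      2 * Fintype.card F ^ 2 := by
  rw [hammingNorm_traceMul, Finset.filter_true_of_mem,
    card_definingSet_of_ne_zero hchar hK he hu hz hLz]
  intro x hx
  rcases traceMul_eq_or_eq_neg hK he hu hz hLz hb hx with ⟨-, h⟩ | ⟨-, h⟩ <;> rw [h]
  · exact hbz
  · exact neg_ne_zero.mpr hbz

theorem traceMul_ne_zero_of_word_ne_zero {b : K}
    (hb : ∀ w, addFrobSq F K w = 0 → (traceMul b w : F) = 0)
    (h0 : (fun d : definingSet F K e u 0 => (traceMul b (d : K) : F)) ≠ 0) :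
    (traceMul b z : F) ≠ 0 := by
  obtain ⟨⟨x, hx⟩, hne⟩ := Function.ne_iff.mp h0
  intro hbz
  apply hne
  rcases traceMul_eq_or_eq_neg hK he hu hz hLz hb hx with ⟨-, h⟩ | ⟨-, h⟩ <;>
    simp [h, hbz]

include hchar in
theorem hammingNorm_traceCode_of_ne_zero {c : definingSet F K e u 0 → F}
    (hc : c ∈ traceCode F (definingSet F K e u 0)) (h0 : c ≠ 0) :
    hammingNorm c = 2 * Fintype.card F ^ 2 - 2 * Fintype.card F ∨
      hammingNorm c = 2 * Fintype.card F ^ 2 := by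
  obtain ⟨b, rfl⟩ := mem_traceCode.mp hc
  by_cases hb : ∃ w, addFrobSq F K w = 0 ∧ (traceMul b w : F) ≠ 0
  · exact Or.inl (hammingNorm_of_exists_ne_zero hchar hK he hu hz hLz hb)
  · push Not at hb
    exact Or.inr (hammingNorm_of_forall_eq_zero hchar hK he hu hz hLz hb
      (traceMul_ne_zero_of_word_ne_zero hK he hu hz hLz hb h0))

omit [DecidableEq F] [DecidableEq K] he hu hLz in
-- L(z) is fixed by the q^2-power map, so L(L(z)x) = L(z)L(x); under the q-power map the two signs
-- cancel. Hence b = L(z) gives a functional that vanishes on ker L but not at z.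
theorem algebraMap_traceMul_addFrobSq {x : K} (hx : Algebra.trace F K x = 0) :
    algebraMap F K (traceMul (addFrobSq F K z) x) = 2 * addFrobSq F K z * addFrobSq F K x := by
  rw [trace_eq_zero_iff hK] at hz hx
  have hodd : (-1 : K) ^ Fintype.card F = -1 := by
    have := FiniteField.pow_card (-1 : F)
    simpa using congrArg (algebraMap F K) this
  have hfix : addFrobSq F K z ^ Fintype.card F ^ 2 = addFrobSq F K z := by
    rw [pow_two, pow_mul, hz, neg_pow, hodd, hz]
    ring
  have hmul : addFrobSq F K (addFrobSq F K z * x) = addFrobSq F K z * addFrobSq F K x := by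
    rw [addFrobSq_apply (addFrobSq F K z * x), mul_pow, hfix, addFrobSq_apply x]
    ring
  rw [traceMul_apply, algebraMap_trace hK, hmul, mul_pow, hz, hx]
  ring

include hchar in
-- The words of top weight are the nonzero multiples of the word of b = L(z).
theorem weightCount_traceCode_top :
    weightCount (traceCode F (definingSet F K e u 0)) (2 * Fintype.card F ^ 2) =
      Fintype.card F - 1 := by
  set y := addFrobSq F K z with hy
  have hyW : ∀ w, addFrobSq F K w = 0 → (traceMul y w : F) = 0 := by
    intro w hw
    apply (algebraMap F K).injective
    rw [algebraMap_traceMul_addFrobSq hK hz (trace_eq_zero_of_addFrobSq_eq_zero hK hw), hw,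
      mul_zero, map_zero]
  have hyz : (traceMul y z : F) ≠ 0 := by
    rw [← map_ne_zero (algebraMap F K), algebraMap_traceMul_addFrobSq hK hz hz]
    have h0 := addFrobSq_ne_zero_of_sq_eq hu hLz
    exact mul_ne_zero (mul_ne_zero (two_ne_zero_of_algebra hchar) h0) h0
  set s : definingSet F K e u 0 → F := fun d => traceMul y (d : K) with hs
  have hsC : s ∈ traceCode F (definingSet F K e u 0) := mem_traceCode.mpr ⟨y, rfl⟩
  have hsn : hammingNorm s = 2 * Fintype.card F ^ 2 :=
    hammingNorm_of_forall_eq_zero hchar hK he hu hz hLz hyW hyz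
  have hq : 0 < Fintype.card F := Fintype.card_pos
  have hs0 : s ≠ 0 := by
    rw [← hammingNorm_ne_zero_iff, hsn]
    positivity
  have hset : {c : definingSet F K e u 0 → F | c ∈ traceCode F (definingSet F K e u 0) ∧
      hammingNorm c = 2 * Fintype.card F ^ 2} =
        (fun a : F => a • s) '' ((Finset.univ.erase 0 : Finset F) : Set F) := by
    ext c
    simp only [Set.mem_image, Finset.mem_coe, Finset.mem_erase, Finset.mem_univ, and_true]
    constructor
    · rintro ⟨hc, hn⟩
      have hc0 : c ≠ 0 := by
        rw [← hammingNorm_ne_zero_iff, hn]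
        positivity
      obtain ⟨b, rfl⟩ := mem_traceCode.mp hc
      have hb : ∀ w, addFrobSq F K w = 0 → (traceMul b w : F) = 0 := by
        by_contra! hb
        rw [hammingNorm_of_exists_ne_zero hchar hK he hu hz hLz hb] at hn
        have : 0 < Fintype.card F ^ 2 := by positivity
        omega
      -- Matching values at z suffices, as both words change sign together between the cosets.
      refine ⟨traceMul b z / traceMul y z, div_ne_zero
        (traceMul_ne_zero_of_word_ne_zero hK he hu hz hLz hb hc0) hyz, ?_⟩
      have h0 := addFrobSq_ne_zero_of_sq_eq hu hLz
      have hne : addFrobSq F K z ≠ -addFrobSq F K z := by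
        rw [Ne, eq_neg_iff_add_eq_zero, ← two_mul]
        exact mul_ne_zero (two_ne_zero_of_algebra hchar) h0
      ext ⟨x, hx⟩
      simp only [hs, Pi.smul_apply, smul_eq_mul]
      rcases traceMul_eq_or_eq_neg hK he hu hz hLz hb hx with ⟨h1, h2⟩ | ⟨h1, h2⟩ <;>
        rcases traceMul_eq_or_eq_neg hK he hu hz hLz hyW hx with ⟨h3, h4⟩ | ⟨h3, h4⟩
      · rw [h2, h4, div_mul_cancel₀ _ hyz]
      · exact absurd (h1.symm.trans h3) hne
      · exact absurd (h3.symm.trans h1) hne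
      · rw [h2, h4, mul_neg, div_mul_cancel₀ _ hyz]
    · rintro ⟨a, ha, rfl⟩
      refine ⟨Submodule.smul_mem _ _ hsC, ?_⟩
      rw [← hsn]
      exact hammingNorm_smul (fun _ => (IsRegular.of_ne_zero ha).left.isSMulRegular) s
  rw [weightCount, hset, Set.ncard_image_of_injective _ (smul_left_injective F hs0),
    Set.ncard_coe_finset, Finset.card_erase_of_mem (Finset.mem_univ _), Finset.card_univ]

end UNeZero

/-! ### Griesmer sums and the parity of e. -/

theorem meetsGriesmer_two {q : ℕ} (hq : 0 < q) : MeetsGriesmer q (q ^ 2 - 1) 2 (q ^ 2 - q) := by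
  obtain ⟨r, rfl⟩ := Nat.exists_eq_succ_of_ne_zero hq.ne'
  have h1 : (r + 1) ^ 2 - (r + 1) = r * (r + 1) := by
    rw [Nat.sub_eq_iff_eq_add (by nlinarith)]
    ring
  have h2 : ((r * (r + 1) : ℕ) : ℚ) / ((r + 1 : ℕ) : ℚ) ^ 1 = (r : ℕ) := by
    have : ((r : ℚ) + 1) ≠ 0 := by positivity
    push_cast
    field_simp
  simp only [MeetsGriesmer, Nat.succ_eq_add_one, h1, Finset.sum_range_succ, Finset.sum_range_zero,
    h2, pow_zero, div_one, Nat.ceil_natCast]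
  rw [Nat.sub_eq_iff_eq_add (Nat.one_le_pow _ _ hq), Nat.succ_eq_add_one]
  ring

theorem meetsGriesmer_three {q : ℕ} (hq : 2 < q) :
    MeetsGriesmer q (2 * q ^ 2) 3 (2 * q ^ 2 - 2 * q) := by
  obtain ⟨r, rfl⟩ := Nat.exists_eq_succ_of_ne_zero (show q ≠ 0 by omega)
  have hr : (1 : ℚ) < r := by
    have : 1 < r := by omega
    exact_mod_cast this
  have h1 : 2 * (r + 1) ^ 2 - 2 * (r + 1) = 2 * r * (r + 1) := by
    rw [Nat.sub_eq_iff_eq_add (by nlinarith)]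
    ring
  have h2 : ((2 * r * (r + 1) : ℕ) : ℚ) / ((r + 1 : ℕ) : ℚ) ^ 1 = (2 * r : ℕ) := by
    have : ((r : ℚ) + 1) ≠ 0 := by positivity
    push_cast
    field_simp
  -- With q = r + 1 the quotient is 2r/(r + 1), which exceeds 1 exactly because q > 2.
  have h3 : ⌈((2 * r * (r + 1) : ℕ) : ℚ) / ((r + 1 : ℕ) : ℚ) ^ 2⌉₊ = 2 := by
    rw [Nat.ceil_eq_iff two_ne_zero]
    push_cast
    constructor
    · rw [lt_div_iff₀ (by positivity)]
      norm_num
      nlinarith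
    · rw [div_le_iff₀ (by positivity)]
      nlinarith
  simp only [MeetsGriesmer, Nat.succ_eq_add_one, h1, Finset.sum_range_succ, Finset.sum_range_zero,
    h2, h3, pow_zero, div_one, Nat.ceil_natCast]
  ring

/-- For even e the gcd is even, so neither of its possible values, 0 and the gcd, is 1. -/
theorem odd_of_epsilon_four_eq_one {e : ℕ} (h : epsilon 4 e = 1) : Odd e := by
  by_contra hodd
  rw [Nat.not_odd_iff_even, even_iff_two_dvd] at hodd
  have hd : 2 ∣ Nat.gcd 4 e := Nat.dvd_gcd (by norm_num) hodd
  rw [epsilon] at h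
  split_ifs at h
  rw [h] at hd
  omega

end QuarticCodes

end FewWeight

/-! ### Assembly of both cases. -/

theorem corollary1 {F K : Type*} [Field F] [Fintype F] [DecidableEq F]
    [Field K] [Fintype K] [DecidableEq K] [Algebra F K]
    (q m e : ℕ) (hq : Fintype.card F = q) (hchar : ringChar F ≠ 2)
    (hK : Module.finrank F K = m) (hm : m = 4) (he : 0 < e)
    (hε : FewWeight.epsilon m e = 1) (u : F) :
    (u = 0 →
      FewWeight.IsWeightCode (FewWeight.traceCode F (FewWeight.definingSet F K e u 0)) 1 ∧
      FewWeight.HasParams (FewWeight.traceCode F (FewWeight.definingSet F K e u 0))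
        (q ^ 2 - 1) 2 (q ^ 2 - q) ∧
      FewWeight.IsOptimal (FewWeight.traceCode F (FewWeight.definingSet F K e u 0))
        (q ^ 2 - 1) 2 (q ^ 2 - q) ∧
      FewWeight.MeetsGriesmer q (q ^ 2 - 1) 2 (q ^ 2 - q) ∧
      FewWeight.weightEnumerator (FewWeight.traceCode F (FewWeight.definingSet F K e u 0)) =
        1 + Polynomial.C ((q : ℤ) ^ 2 - 1) * Polynomial.X ^ ((q - 1) * q)) ∧
    (u ≠ 0 → quadraticChar F (-(u * (m : F))) = -1 →
      FewWeight.IsWeightCode (FewWeight.traceCode F (FewWeight.definingSet F K e u 0)) 2 ∧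
      FewWeight.HasParams (FewWeight.traceCode F (FewWeight.definingSet F K e u 0))
        (2 * q ^ 2) 3 (2 * q ^ 2 - 2 * q) ∧
      FewWeight.IsOptimal (FewWeight.traceCode F (FewWeight.definingSet F K e u 0))
        (2 * q ^ 2) 3 (2 * q ^ 2 - 2 * q) ∧
      FewWeight.MeetsGriesmer q (2 * q ^ 2) 3 (2 * q ^ 2 - 2 * q) ∧
      FewWeight.weightEnumerator (FewWeight.traceCode F (FewWeight.definingSet F K e u 0)) =
        1 + Polynomial.C ((q : ℤ) ^ 3 - q) * Polynomial.X ^ (2 * q * (q - 1)) +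
          Polynomial.C ((q : ℤ) - 1) * Polynomial.X ^ (2 * q ^ 2)) := by
  subst hq hm
  have hodd := FewWeight.odd_of_epsilon_four_eq_one hε
  have hq2 := FewWeight.two_lt_card hchar
  have hsub : Fintype.card F ^ 2 - Fintype.card F = (Fintype.card F - 1) * Fintype.card F := by
    rw [Nat.sub_mul, one_mul, pow_two]
  have hsub' : 2 * Fintype.card F ^ 2 - 2 * Fintype.card F =
      2 * Fintype.card F * (Fintype.card F - 1) := by
    rw [Nat.mul_sub, mul_one, mul_assoc, pow_two]
  have hd : 0 < Fintype.card F ^ 2 - Fintype.card F := by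
    rw [hsub]
    exact Nat.mul_pos (by omega) (by omega)
  refine ⟨?_, ?_⟩
  · rintro rfl
    have hw := fun c hc h0 => FewWeight.hammingNorm_traceCode_zero (c := c) hK hodd hc h0
    have hk := FewWeight.finrank_traceCode_zero hK hodd
    have hpar : FewWeight.HasParams (FewWeight.traceCode F (FewWeight.definingSet F K e 0 0))
        (Fintype.card F ^ 2 - 1) 2 (Fintype.card F ^ 2 - Fintype.card F) := by
      refine ⟨by rw [Fintype.card_coe, FewWeight.card_definingSet_zero hK hodd], hk, ?_⟩
      refine FewWeight.hasMinDist_of_hammingNorm ?_ fun c hc h0 => (hw c hc h0).ge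
      obtain ⟨c, hc, h0⟩ := Submodule.exists_mem_ne_zero_of_ne_bot (p :=
        FewWeight.traceCode F (FewWeight.definingSet F K e 0 0)) (by
          intro h
          rw [h, finrank_bot] at hk
          omega)
      exact ⟨c, hc, h0, hw c hc h0⟩
    have hG := FewWeight.meetsGriesmer_two (q := Fintype.card F) (by omega)
    obtain ⟨h1, h2⟩ := FewWeight.weightEnumerator_of_one_weight hk two_pos hd hw
    refine ⟨h1, hpar, hpar.isOptimal_of_meetsGriesmer hG two_pos hd, hG, ?_⟩
    rw [h2, hsub]
  · intro hu hη
    have hns : ¬ IsSquare (-u) := by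
      rw [quadraticChar_neg_one_iff_not_isSquare] at hη
      rintro ⟨r, hr⟩
      -- If -u = r^2 then -4u = (2r)^2: the factor m = 4 does not affect the character.
      refine hη ⟨2 * r, ?_⟩
      push_cast
      linear_combination 4 * hr
    obtain ⟨z, hz, hLz⟩ := FewWeight.exists_addFrobSq_sq_eq (K := K) hchar hK hns
    rw [map_neg] at hLz
    have hw := fun c hc h0 =>
      FewWeight.hammingNorm_traceCode_of_ne_zero (c := c) hchar hK hodd hu hz hLz hc h0
    have hk := FewWeight.finrank_traceCode_of_ne_zero hK hodd hu hz hLz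
    have hd' : 0 < 2 * Fintype.card F ^ 2 - 2 * Fintype.card F := by omega
    have hlt : 2 * Fintype.card F ^ 2 - 2 * Fintype.card F < 2 * Fintype.card F ^ 2 := by omega
    have hcube : Fintype.card F - 1 + 1 < Fintype.card F ^ 3 := by
      rw [Nat.sub_add_cancel (by omega)]
      exact lt_self_pow₀ (by omega) (by norm_num)
    obtain ⟨h1, h2, h3⟩ := FewWeight.weightEnumerator_of_two_weight hk hd' hlt hw
      (FewWeight.weightCount_traceCode_top hchar hK hodd hu hz hLz) (by omega) hcube
    have hpar : FewWeight.HasParams (FewWeight.traceCode F (FewWeight.definingSet F K e u 0))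
        (2 * Fintype.card F ^ 2) 3 (2 * Fintype.card F ^ 2 - 2 * Fintype.card F) := by
      refine ⟨by rw [Fintype.card_coe,
        FewWeight.card_definingSet_of_ne_zero hchar hK hodd hu hz hLz], hk, ?_⟩
      refine FewWeight.hasMinDist_of_hammingNorm ?_ fun c hc h0 => ?_
      -- The smaller weight is attained because its count, obtained by subtraction, is nonzero.
      · by_contra! hne
        refine h3 (FewWeight.weightCount_eq_zero fun c hc hcw => hne c hc ?_ hcw)
        rw [← hammingNorm_ne_zero_iff, hcw]
        exact hd'.ne'
      · rcases hw c hc h0 with h | h <;> omega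
    have hG := FewWeight.meetsGriesmer_three hq2
    refine ⟨h1, hpar, hpar.isOptimal_of_meetsGriesmer hG three_pos hd', hG, ?_⟩
    rw [h2, hsub', Nat.cast_sub (by omega), Nat.cast_one, sub_sub, add_sub_cancel]
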